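/- Let $M$ be a smooth $n$-dimensional (Hausdorff) manifold without boundary, $g$ a smooth Riemannian metric on $M$ and $\nabla$ a smooth torsion-free affine connection on $M$ such that $(M,g,\nabla)$ is a statistical manifold, i.e. the cubic form $$Q(X,Y,Z)=(\nabla_X g)(Y,Z)=X\,g(Y,Z)-g(\nabla_XY,Z)-g(Y,\nabla_XZ)$$ is totally symmetric. Let $\nabla^*$ be the dual connection of $\nabla$, i.e. the smooth affine connection with $X\,g(Y,Z)=g(\nabla_XY,Z)+g(Y,\nabla^*_XZ)$ for all smooth vector fields $X,Y,Z$. Let $R(X,Y)Z=\nabla_X\nabla_YZ-\nabla_Y\nabla_XZ-\nabla_{[X,Y]}Z$ and $\mathrm{Ric}(Y,Z)=\operatorname{tr}\{X\mapsto R(X,Y)Z\}$ be the curvature and Ricci tensors of $\nabla$, and let $\mathrm{Ric}^*$ be the Ricci tensor of $\nabla^*$, defined in the same way. Suppose that $(M,g,\nabla,\nabla^*)$ is conjugate Ricci-symmetric, i.e. $\mathrm{Ric}(Y,Z)=\mathrm{Ric}^*(Y,Z)$ for all smooth vector fields $Y,Z$. Then $\nabla$ is (locally) equiaffine: its Ricci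 tensor is symmetric, $\mathrm{Ric}(Y,Z)=\mathrm{Ric}(Z,Y)$ for all smooth vector fields $Y,Z$, and every point of $M$ has an open neighbourhood $U$ carrying a parallel volume form, i.e. a smooth nowhere vanishing $n$-form $\omega$ on $U$ with $\nabla\omega=0$. -/

import Mathlib

open Bundle
open scoped Manifold ContDiff

noncomputable section

/-- Affine connections on an `n`-dimensional manifold `M`, as covariant derivatives on the tangent
bundle. On paper `(∇_X Y)(x)` is `nab Y x (X x)`. Smoothness of the connection is Mathlib's class
`CovariantDerivative.ContMDiffCovariantDerivative nab ∞`. -/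
abbrev AffineConnection (n : ℕ) (M : Type*) [TopologicalSpace M]
    [ChartedSpace (EuclideanSpace ℝ (Fin n)) M] [IsManifold (𝓡 n) ∞ M] :=
  CovariantDerivative (𝓡 n) (EuclideanSpace ℝ (Fin n)) (TangentSpace (𝓡 n) : M → Type _)

/-- Smooth vector fields on `M`. -/
abbrev SmoothVectorField (n : ℕ) (M : Type*) [TopologicalSpace M]
    [ChartedSpace (EuclideanSpace ℝ (Fin n)) M] [IsManifold (𝓡 n) ∞ M] :=
  ContMDiffSection (𝓡 n) (EuclideanSpace ℝ (Fin n)) ∞ (TangentSpace (𝓡 n) : M → Type _)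

/-- Smooth Riemannian metrics on `M`; the inner product at `x` is `g.inner x`. -/
abbrev SmoothMetric (n : ℕ) (M : Type*) [TopologicalSpace M]
    [ChartedSpace (EuclideanSpace ℝ (Fin n)) M] [IsManifold (𝓡 n) ∞ M] :=
  ContMDiffRiemannianMetric (𝓡 n) ∞ (EuclideanSpace ℝ (Fin n))
    (fun x : M ↦ TangentSpace (𝓡 n) x)

namespace AffineConnection

variable {n : ℕ} {M : Type*} [TopologicalSpace M]
  [ChartedSpace (EuclideanSpace ℝ (Fin n)) M] [IsManifold (𝓡 n) ∞ M]

/-- The cubic form `Q(X, Y, Z) = (∇_X g)(Y, Z) = X g(Y, Z) - g(∇_X Y, Z) - g(Y, ∇_X Z)`. -/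
def cubicForm (g : SmoothMetric n M) (nab : AffineConnection n M)
    (X Y Z : SmoothVectorField n M) (x : M) : ℝ :=
  mvfderiv (𝓡 n) (fun y ↦ g.inner y (Y y) (Z y)) x (X x)
    - g.inner x (nab Y x (X x)) (Z x) - g.inner x (Y x) (nab Z x (X x))

/-- `(M, g, ∇)` is a statistical manifold: `∇` is torsion-free and the cubic form `∇g` is totally
symmetric (the two transpositions below generate all permutations of the arguments). -/
structure IsStatistical (g : SmoothMetric n M) (nab : AffineConnection n M) : Prop where
  torsion_free : CovariantDerivative.torsion nab = 0
  symm_left : ∀ (X Y Z : SmoothVectorField n M) (x : M),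
    cubicForm g nab X Y Z x = cubicForm g nab Y X Z x
  symm_right : ∀ (X Y Z : SmoothVectorField n M) (x : M),
    cubicForm g nab X Y Z x = cubicForm g nab X Z Y x

/-- `∇*` is the dual connection of `∇` with respect to `g`:
`X g(Y, Z) = g(∇_X Y, Z) + g(Y, ∇*_X Z)`. -/
def IsDual (g : SmoothMetric n M) (nab nabS : AffineConnection n M) : Prop :=
  ∀ (X Y Z : SmoothVectorField n M) (x : M),
    mvfderiv (𝓡 n) (fun y ↦ g.inner y (Y y) (Z y)) x (X x)
      = g.inner x (nab Y x (X x)) (Z x) + g.inner x (Y x) (nabS Z x (X x))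

/-- The vector field `X` is differentiable at `x`. -/
abbrev IsDiffFieldAt (X : ∀ x : M, TangentSpace (𝓡 n) x) (x : M) : Prop :=
  MDifferentiableAt (𝓡 n) ((𝓡 n).prod 𝓘(ℝ, EuclideanSpace ℝ (Fin n)))
    (fun y ↦ TotalSpace.mk' (EuclideanSpace ℝ (Fin n)) y (X y)) x

/-- `∇_X ∇_Y Z - ∇_Y ∇_X Z - ∇_{[X, Y]} Z` at `x`. -/
def curvatureAux (nab : AffineConnection n M) (Z X Y : ∀ x : M, TangentSpace (𝓡 n) x) (x : M) :
    TangentSpace (𝓡 n) x :=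
  nab (fun y ↦ nab Z y (Y y)) x (X x) - nab (fun y ↦ nab Z y (X y)) x (Y x)
    - nab Z x (VectorField.mlieBracket (𝓡 n) X Y x)

theorem curvatureAux_swap (nab : AffineConnection n M) (Z X Y : ∀ x : M, TangentSpace (𝓡 n) x) (x : M) :
    curvatureAux nab Z X Y x = - curvatureAux nab Z Y X x := by
  simp only [curvatureAux]
  rw [VectorField.mlieBracket_swap]
  simp
  module

variable (nab : AffineConnection n M) [CovariantDerivative.ContMDiffCovariantDerivative nab ∞]

theorem mdifferentiableAt_nab (Z : SmoothVectorField n M) {X : ∀ x : M, TangentSpace (𝓡 n) x}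
    {x : M} (hX : IsDiffFieldAt X x) : IsDiffFieldAt (fun y ↦ nab Z y (X y)) x := by
  have h := ‹CovariantDerivative.ContMDiffCovariantDerivative nab ∞›
  have h1 := (h.contMDiff.contMDiff (σ := Z) (by
    simpa using! Z.contMDiff.contMDiffOn)).contMDiffAt (x := x) Filter.univ_mem
  exact (h1.mdifferentiableAt (by simp)).clm_bundle_apply hX

theorem tensorialAt_curvatureAux_left (Z : SmoothVectorField n M) (x : M)
    (Y : ∀ x : M, TangentSpace (𝓡 n) x) :
    TensorialAt (𝓡 n) (EuclideanSpace ℝ (Fin n)) (curvatureAux nab Z · Y x) x where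
  smul {f X} hf hX := by
    have e : (fun y ↦ nab Z y ((f • X) y)) = f • (fun y ↦ nab Z y (X y)) := by
      ext1 y; simp
    simp only [curvatureAux, e, VectorField.mlieBracket_smul_left hf hX,
      nab.isCovariantDerivativeOn.leibniz (mdifferentiableAt_nab nab Z hX) hf]
    simp
    module
  add {X X'} hX hX' := by
    have e : (fun y ↦ nab Z y ((X + X') y)) =
        (fun y ↦ nab Z y (X y)) + (fun y ↦ nab Z y (X' y)) := by
      ext1 y; simp
    simp only [curvatureAux, e, VectorField.mlieBracket_add_left hX hX',
      nab.isCovariantDerivativeOn.add (mdifferentiableAt_nab nab Z hX)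
        (mdifferentiableAt_nab nab Z hX')]
    simp
    module

theorem tensorialAt_curvatureAux_right (Z : SmoothVectorField n M) (x : M)
    (X : ∀ x : M, TangentSpace (𝓡 n) x) :
    TensorialAt (𝓡 n) (EuclideanSpace ℝ (Fin n)) (curvatureAux nab Z X · x) x where
  smul hf hY := by
    simp only [curvatureAux_swap nab Z X,
      (tensorialAt_curvatureAux_left nab Z x X).smul hf hY, smul_neg]
  add hY hY' := by
    simp only [curvatureAux_swap nab Z X,
      (tensorialAt_curvatureAux_left nab Z x X).add hY hY', neg_add]

/-- The curvature `(u, v) ↦ R(u, v)Z` at `x`, for tangent vectors `u`, `v` at `x` and a smooth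
vector field `Z`. -/
def curvature (Z : SmoothVectorField n M) (x : M) :
    TangentSpace (𝓡 n) x →L[ℝ] TangentSpace (𝓡 n) x →L[ℝ] TangentSpace (𝓡 n) x :=
  TensorialAt.mkHom₂ (fun X Y ↦ curvatureAux nab Z X Y x) x
    (fun Y _ ↦ tensorialAt_curvatureAux_left nab Z x Y)
    (fun X _ ↦ tensorialAt_curvatureAux_right nab Z x X)

/-- `R(X, Y)Z = ∇_X ∇_Y Z - ∇_Y ∇_X Z - ∇_{[X, Y]} Z`. -/
theorem curvature_apply (Z : SmoothVectorField n M) {x : M}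
    {X Y : ∀ x : M, TangentSpace (𝓡 n) x} (hX : IsDiffFieldAt X x) (hY : IsDiffFieldAt Y x) :
    curvature nab Z x (X x) (Y x) =
      nab (fun y ↦ nab Z y (Y y)) x (X x) - nab (fun y ↦ nab Z y (X y)) x (Y x)
        - nab Z x (VectorField.mlieBracket (𝓡 n) X Y x) :=
  TensorialAt.mkHom₂_apply _ _ hX hY

/-- The Ricci tensor `Ric(Y, Z) = tr (u ↦ R(u, Y)Z)` at `x`. -/
def ricci (Y Z : SmoothVectorField n M) (x : M) : ℝ :=
  LinearMap.trace ℝ (TangentSpace (𝓡 n) x)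
    ((ContinuousLinearMap.coeLM ℝ ∘ₗ (curvature nab Z x).toLinearMap).flip (Y x))

/-- The Ricci tensor of `∇` is symmetric. -/
def IsRicciSymmetric : Prop :=
  ∀ (Y Z : SmoothVectorField n M) (x : M), ricci nab Y Z x = ricci nab Z Y x

/-- Conjugate Ricci-symmetry of the pair `(∇, ∇*)`: `Ric(Y, Z) = Ric*(Y, Z)`. -/
def IsConjugateRicciSymmetric (nabS : AffineConnection n M)
    [CovariantDerivative.ContMDiffCovariantDerivative nabS ∞] : Prop :=
  ∀ (Y Z : SmoothVectorField n M) (x : M), ricci nab Y Z x = ricci nabS Y Z x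

end AffineConnection

section VolumeForm

variable {n : ℕ} {M : Type*} [TopologicalSpace M]
  [ChartedSpace (EuclideanSpace ℝ (Fin n)) M] [IsManifold (𝓡 n) ∞ M]

/-- The vector field `X` is smooth on `U`. -/
abbrev IsSmoothFieldOn (U : Set M) (X : ∀ x : M, TangentSpace (𝓡 n) x) : Prop :=
  ContMDiffOn (𝓡 n) ((𝓡 n).prod 𝓘(ℝ, EuclideanSpace ℝ (Fin n))) ∞
    (fun y ↦ TotalSpace.mk' (EuclideanSpace ℝ (Fin n)) y (X y)) U

/-- `vol` is a volume form on the open set `U`: a smooth `n`-form, i.e. `vol(Y₁, …, Yₙ)` is smooth on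
`U` for all vector fields `Yᵢ` that are smooth on `U`, which vanishes nowhere on `U`.
The values of `vol` outside `U` are irrelevant. -/
structure IsVolumeFormOn (U : Set M) (vol : ∀ x : M, TangentSpace (𝓡 n) x [⋀^Fin n]→ₗ[ℝ] ℝ) :
    Prop where
  smooth : ∀ Y : Fin n → ∀ x : M, TangentSpace (𝓡 n) x, (∀ i, IsSmoothFieldOn U (Y i)) →
    ContMDiffOn (𝓡 n) 𝓘(ℝ, ℝ) ∞ (fun x ↦ vol x (fun i ↦ Y i x)) U
  ne_zero : ∀ x ∈ U, vol x ≠ 0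

namespace AffineConnection

/-- `(∇_v vol)(Y₁, …, Yₙ) = v (vol(Y₁, …, Yₙ)) - ∑ᵢ vol(Y₁, …, ∇_v Yᵢ, …, Yₙ)` for a tangent vector `v`
at `x`. -/
def covDerivForm (nab : AffineConnection n M)
    (vol : ∀ x : M, TangentSpace (𝓡 n) x [⋀^Fin n]→ₗ[ℝ] ℝ)
    (Y : Fin n → ∀ x : M, TangentSpace (𝓡 n) x) (x : M) (v : TangentSpace (𝓡 n) x) : ℝ :=
  mvfderiv (𝓡 n) (fun y ↦ vol y (fun i ↦ Y i y)) x v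
    - ∑ i, vol x (Function.update (fun j ↦ Y j x) i (nab (Y i) x v))

/-- `∇vol = 0` on the open set `U`. -/
def IsParallelOn (nab : AffineConnection n M) (U : Set M)
    (vol : ∀ x : M, TangentSpace (𝓡 n) x [⋀^Fin n]→ₗ[ℝ] ℝ) : Prop :=
  ∀ Y : Fin n → ∀ x : M, TangentSpace (𝓡 n) x, (∀ i, IsSmoothFieldOn U (Y i)) →
    ∀ x ∈ U, ∀ v : TangentSpace (𝓡 n) x, covDerivForm nab vol Y x v = 0

/-- `∇` is a (locally) equiaffine connection: every point has an open neighbourhood that carries a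
parallel volume form. -/
def IsEquiaffine (nab : AffineConnection n M) : Prop :=
  ∀ p : M, ∃ U : Set M, IsOpen U ∧ p ∈ U ∧
    ∃ vol : ∀ x : M, TangentSpace (𝓡 n) x [⋀^Fin n]→ₗ[ℝ] ℝ,
      IsVolumeFormOn U vol ∧ IsParallelOn nab U vol

end AffineConnection

end VolumeForm

end

/-!
Duality gives `g(R(X, Y)Z, W) = -g(Z, R*(X, Y)W)`, hence `tr R = -tr R*`. By the first Bianchi
identity the skew part `Ric(Y, Z) - Ric(Z, Y)` of the Ricci tensor of a torsion-free connection is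
`-tr R(Y, Z)`, and `∇*` is torsion-free because the cubic form is symmetric. So `Ric` and `Ric*`
have opposite skew parts, and `Ric = Ric*` forces both to be symmetric and `tr R = 0`. In a chart,
`tr R` is the exterior derivative of the trace `θ` of the connection form, so `θ = df` near each
point, and `e^f dx₁ ∧ ⋯ ∧ dxₙ` is parallel because `∇(dx₁ ∧ ⋯ ∧ dxₙ) = -θ ⊗ dx₁ ∧ ⋯ ∧ dxₙ`.
-/

noncomputable section

/-! ### Iterated derivatives and Lie brackets -/

section LieBracket

open VectorField

variable {𝕜 : Type*} {E : Type*} [NormedAddCommGroup E] {H : Type*} [TopologicalSpace H]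
  {M : Type*} [TopologicalSpace M] [ChartedSpace H M]

theorem contMDiffAt_mvfderiv_apply [NontriviallyNormedField 𝕜] [NormedSpace 𝕜 E]
    {I : ModelWithCorners 𝕜 E H} [IsManifold I 1 M] {F : Type*} [NormedAddCommGroup F]
    [NormedSpace 𝕜 F] {m k : ℕ∞ω} {f : M → F} {X : ∀ x : M, TangentSpace I x} {x : M}
    (hf : CMDiffAt k f x) (hX : CMDiffAt m (T% X) x) (hmk : m + 1 ≤ k) :
    CMDiffAt m (fun y ↦ d% f y (X y)) x := by
  have hdf : ContMDiffAt I (I.prod 𝓘(𝕜, E →L[𝕜] F)) m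
      (fun y ↦ TotalSpace.mk' (E →L[𝕜] F)
        (E := fun y : M ↦ TangentSpace I y →L[𝕜] Bundle.Trivial M F y) y (d% f y)) x := by
    rw [contMDiffAt_hom_bundle]
    refine ⟨contMDiffAt_id, ?_⟩
    convert hf.mfderiv_const hmk using 1
    ext y v
    simp only [inTangentCoordinates, ContinuousLinearMap.inCoordinates,
      Trivial.fiberBundle_trivializationAt', Trivial.continuousLinearMapAt_trivialization,
      TangentBundle.continuousLinearMapAt_model_space, ContinuousLinearMap.comp_apply]
    rfl
  exact (contMDiffAt_section x).1 (hdf.clm_bundle_apply hX)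

variable [RCLike 𝕜] [NormedSpace 𝕜 E] [CompleteSpace E] {I : ModelWithCorners 𝕜 E H}
  [IsManifold I 3 M] {f : M → 𝕜} {X Y Z : ∀ x : M, TangentSpace I x} {x : M}

theorem mlieBracket_mlieBracket_smul_right (hf : CMDiffAt 2 f x) (hY : CMDiffAt 2 (T% Y) x)
    (hZ : CMDiffAt 2 (T% Z) x) :
    mlieBracket I X (mlieBracket I Y (f • Z)) x =
      d% (fun y ↦ d% f y (Y y)) x (X x) • Z x + d% f x (Y x) • mlieBracket I X Z x
        + (d% f x (X x) • mlieBracket I Y Z x + f x • mlieBracket I X (mlieBracket I Y Z) x) := by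
  have : IsManifold I 1 M := IsManifold.of_le (n := 3) (by norm_num)
  have : IsManifold I 2 M := IsManifold.of_le (n := 3) (by norm_num)
  have : IsManifold I (minSmoothness 𝕜 2) M := by simpa
  have : IsManifold I (((2 : ℕ∞) : ℕ∞ω) + 1) M := ‹IsManifold I 3 M›
  have hf₁ : CMDiffAt 1 f x := hf.of_le one_le_two
  have hZ₁ : CMDiffAt 1 (T% Z) x := hZ.of_le one_le_two
  have hf' : MDiffAt f x := hf₁.mdifferentiableAt one_ne_zero
  have hZ' : MDiffAt (T% Z) x := hZ₁.mdifferentiableAt one_ne_zero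
  have hfY : MDiffAt (fun y ↦ d% f y (Y y)) x :=
    (contMDiffAt_mvfderiv_apply (m := 1) hf (hY.of_le one_le_two) le_rfl).mdifferentiableAt
      one_ne_zero
  have hYZ : MDiffAt (T% (mlieBracket I Y Z)) x :=
    (hY.mlieBracket_vectorField (n := 2) (m := 1) hZ (by
      simp only [WithTop.coe_one, minSmoothness_of_isRCLikeNormedField, WithTop.coe_ofNat]
      rfl)).mdifferentiableAt one_ne_zero
  have hleib : mlieBracket I Y (f • Z) =ᶠ[nhds x]
      (fun y ↦ d% f y (Y y)) • Z + f • mlieBracket I Y Z := by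
    filter_upwards [(contMDiffAt_iff_contMDiffAt_nhds (by simp)).1 hf₁,
      (contMDiffAt_iff_contMDiffAt_nhds (by simp)).1 hZ₁] with y hfy hZy
    exact mlieBracket_smul_right (hfy.mdifferentiableAt one_ne_zero)
      (hZy.mdifferentiableAt one_ne_zero)
  rw [Filter.EventuallyEq.rfl.mlieBracket_vectorField_eq hleib,
    mlieBracket_add_right (hfY.smul_section hZ') (hf'.smul_section hYZ),
    mlieBracket_smul_right hfY hZ', mlieBracket_smul_right hf' hYZ]

-- Comparing the Jacobi identities for `X, Y, Z` and `X, Y, f Z` isolates the derivatives of `f`.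
theorem mvfderiv_mlieBracket (hf : CMDiffAt 2 f x) (hX : CMDiffAt 2 (T% X) x)
    (hY : CMDiffAt 2 (T% Y) x) :
    d% f x (mlieBracket I X Y x) =
      d% (fun y ↦ d% f y (Y y)) x (X x) - d% (fun y ↦ d% f y (X y)) x (Y x) := by
  have : IsManifold I 2 M := IsManifold.of_le (n := 3) (by norm_num)
  have : IsManifold I (minSmoothness 𝕜 3) M := by simpa
  rcases subsingleton_or_nontrivial (TangentSpace I x) with _ | _
  · simp only [Subsingleton.elim _ (0 : TangentSpace I x), map_zero, sub_zero]
  obtain ⟨v, hv⟩ := exists_ne (0 : TangentSpace I x)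
  obtain ⟨Z, hZ, hZx⟩ : ∃ Z : ∀ y : M, TangentSpace I y, CMDiffAt 2 (T% Z) x ∧ Z x = v :=
    ⟨_, FiberBundle.contMDiffAt_extend I E v, FiberBundle.extend_apply_self E v⟩
  have jacobi {W : ∀ y : M, TangentSpace I y} (hW : CMDiffAt 2 (T% W) x) :
      mlieBracket I X (mlieBracket I Y W) x =
        mlieBracket I (mlieBracket I X Y) W x + mlieBracket I Y (mlieBracket I X W) x :=
    leibniz_identity_mlieBracket_apply (by simpa) (by simpa) (by simpa)
  have hfZ := jacobi (hf.smul_section hZ)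
  rw [mlieBracket_mlieBracket_smul_right hf hY hZ, mlieBracket_mlieBracket_smul_right hf hX hZ,
    mlieBracket_smul_right (hf.mdifferentiableAt two_ne_zero) (hZ.mdifferentiableAt two_ne_zero),
    jacobi hZ, smul_add, hZx] at hfZ
  refine smul_left_injective 𝕜 hv ?_
  simp only [sub_smul]
  linear_combination (norm := module) -hfZ

end LieBracket

/-! ### Derivatives of determinants and sums -/

section Determinant

open Matrix

variable {ι R : Type*} [Fintype ι] [DecidableEq ι]

theorem det_updateRow_eq_sum_mul_adjugate [CommRing R] (A : Matrix ι ι R) (i : ι) (v : ι → R) :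
    (A.updateRow i v).det = ∑ j, v j * A.adjugate j i := by
  rw [← cramer_transpose_apply, cramer_eq_adjugate_mulVec, ← adjugate_transpose]
  simp only [mulVec, dotProduct, transpose_apply, mul_comm]

theorem sum_det_updateRow_mul [CommRing R] (A B : Matrix ι ι R) :
    ∑ i, (A.updateRow i ((A * B) i)).det = B.trace * A.det := by
  calc ∑ i, (A.updateRow i ((A * B) i)).det = (A * B * A.adjugate).trace := by
        simp only [det_updateRow_eq_sum_mul_adjugate, trace, diag, mul_apply (M := A * B)]
    _ = B.trace * A.det := by
        rw [trace_mul_comm, ← Matrix.mul_assoc, adjugate_mul, smul_mul, Matrix.one_mul, trace_smul,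
          smul_eq_mul, mul_comm]

variable {𝕜 : Type*} [NontriviallyNormedField 𝕜] {E : Type*} [NormedAddCommGroup E]
  [NormedSpace 𝕜 E] {H : Type*} [TopologicalSpace H] {I : ModelWithCorners 𝕜 E H} {M : Type*}
  [TopologicalSpace M] [ChartedSpace H M]

variable (ι 𝕜) in
/-- The determinant as a continuous multilinear function of the rows, which makes the calculus of
multilinear maps available for it. -/
def detRowCLM : ContinuousMultilinearMap 𝕜 (fun _ : ι ↦ ι → 𝕜) 𝕜 where
  toMultilinearMap := (detRowAlternating (R := 𝕜) (n := ι)).toMultilinearMap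
  cont := Continuous.matrix_det continuous_id

theorem contMDiffOn_det {k : ℕ∞ω} {A : M → Matrix ι ι 𝕜} {U : Set M}
    (hA : ∀ i j, CMDiff[U] k (fun y ↦ A y i j)) : CMDiff[U] k (fun y ↦ (A y).det) :=
  (detRowCLM ι 𝕜).contDiff.contMDiff.comp_contMDiffOn
    (contMDiffOn_pi_space.2 fun i ↦ contMDiffOn_pi_space.2 fun j ↦ hA i j)

theorem mdifferentiableAt_pi_space {κ : Type*} [Fintype κ] {F : κ → Type*}
    [∀ i, NormedAddCommGroup (F i)] [∀ i, NormedSpace 𝕜 (F i)] {f : M → ∀ i, F i} {x : M} :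
    MDifferentiableAt I 𝓘(𝕜, ∀ i, F i) f x ↔
      ∀ i, MDifferentiableAt I 𝓘(𝕜, F i) (fun y ↦ f y i) x := by
  simp only [mdifferentiableAt_iff, continuousAt_pi, forall_and, writtenInExtChartAt,
    extChartAt_model_space_eq_id, PartialEquiv.refl_coe, Function.id_comp]
  exact and_congr_right fun _ ↦ differentiableWithinAt_pi

theorem mvfderiv_comp_of_hasFDerivAt {F G : Type*} [NormedAddCommGroup F] [NormedSpace 𝕜 F]
    [NormedAddCommGroup G] [NormedSpace 𝕜 G] {h : F → G} {h' : F →L[𝕜] G} {f : M → F} {x : M}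
    (hh : HasFDerivAt h h' (f x)) (hf : MDiffAt f x) (v : TangentSpace I x) :
    d% (fun y ↦ h (f y)) x v = h' (d% f x v) := by
  have := (hh.hasMFDerivAt.comp x hf.hasMFDerivAt).mfderiv
  exact congrArg (fun L : TangentSpace I x →L[𝕜] G ↦ L v) this

theorem mdifferentiableAt_det {A : M → Matrix ι ι 𝕜} {x : M}
    (hA : ∀ i j, MDiffAt (fun y ↦ A y i j) x) : MDiffAt (fun y ↦ (A y).det) x :=
  ((detRowCLM ι 𝕜).hasFDerivAt _).differentiableAt.mdifferentiableAt.comp x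
    (mdifferentiableAt_pi_space.2 fun i ↦ mdifferentiableAt_pi_space.2 (hA i))

theorem mvfderiv_det {A : M → Matrix ι ι 𝕜} {x : M} (hA : ∀ i j, MDiffAt (fun y ↦ A y i j) x)
    (v : TangentSpace I x) :
    d% (fun y ↦ (A y).det) x v =
      ∑ i, ((A x).updateRow i fun j ↦ d% (fun y ↦ A y i j) x v).det := by
  let rows : M → ι → ι → 𝕜 := A
  have hrows : MDifferentiableAt I 𝓘(𝕜, ι → ι → 𝕜) rows x :=
    mdifferentiableAt_pi_space.2 fun i ↦ mdifferentiableAt_pi_space.2 (hA i)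
  have hentry (i j : ι) : d% (fun y ↦ A y i j) x v = mvfderiv I rows x v i j := by
    let entry : (ι → ι → 𝕜) →L[𝕜] 𝕜 :=
      (ContinuousLinearMap.proj (φ := fun _ : ι ↦ 𝕜) j).comp (ContinuousLinearMap.proj i)
    exact mvfderiv_comp_of_hasFDerivAt entry.hasFDerivAt hrows v
  simp only [hentry]
  exact (mvfderiv_comp_of_hasFDerivAt ((detRowCLM ι 𝕜).hasFDerivAt (A x)) hrows v).trans
    ((detRowCLM ι 𝕜).linearDeriv_apply (A x) _)

end Determinant

section FunSum

variable {𝕜 : Type*} [NontriviallyNormedField 𝕜] {E : Type*} [NormedAddCommGroup E]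
  [NormedSpace 𝕜 E] {H : Type*} [TopologicalSpace H] {I : ModelWithCorners 𝕜 E H} {M : Type*}
  [TopologicalSpace M] [ChartedSpace H M] {F : Type*} [NormedAddCommGroup F] [NormedSpace 𝕜 F]

theorem mvfderiv_fun_sum {ι : Type*} {s : Finset ι} {f : ι → M → F} {x : M}
    (hf : ∀ i ∈ s, MDiffAt (f i) x) :
    d% (fun y ↦ ∑ i ∈ s, f i y) x = ∑ i ∈ s, d% (f i) x := by
  have hsum : HasMFDerivAt I 𝓘(𝕜, F) (fun y ↦ ∑ i ∈ s, f i y) x (∑ i ∈ s, d% (f i) x) :=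
    ⟨tendsto_finsetSum s fun i hi ↦ (hf i hi).continuousAt,
      HasFDerivWithinAt.fun_sum fun i hi ↦ (hf i hi).hasMFDerivAt.2⟩
  exact hsum.mfderiv

end FunSum

/-! ### The Poincaré lemma -/

theorem exists_contDiffOn_hasFDerivAt {E F : Type*} [NormedAddCommGroup E] [NormedSpace ℝ E]
    [NormedAddCommGroup F] [NormedSpace ℝ F] [CompleteSpace F] {W : Set E} (hW : IsOpen W) {a : E}
    (ha : a ∈ W) {η : E → E →L[ℝ] F} (hη : ContDiffOn ℝ ∞ η W)
    (hsymm : ∀ z ∈ W, ∀ u v, fderiv ℝ η z u v = fderiv ℝ η z v u) :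
    ∃ B ⊆ W, IsOpen B ∧ a ∈ B ∧ ∃ f : E → F, ContDiffOn ℝ ∞ f B ∧
      ∀ z ∈ B, HasFDerivAt f (η z) z := by
  obtain ⟨r, hr, hrW⟩ := Metric.isOpen_iff.1 hW a ha
  obtain ⟨f, hf⟩ := (convex_ball a r).exists_forall_hasFDerivAt_of_fderiv_symmetric
    Metric.isOpen_ball ((hη.mono hrW).differentiableOn (by simp)) fun z hz ↦ hsymm z (hrW hz)
  refine ⟨Metric.ball a r, hrW, Metric.isOpen_ball, Metric.mem_ball_self hr, f, ?_, hf⟩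
  rw [contDiffOn_infty_iff_fderiv_of_isOpen Metric.isOpen_ball]
  exact ⟨fun z hz ↦ (hf z hz).differentiableAt.differentiableWithinAt,
    (hη.mono hrW).congr fun z hz ↦ (hf z hz).fderiv⟩

theorem exists_contDiffOn_hasFDerivAt_sum_smul_proj {ι : Type*} [Fintype ι]
    {W : Set (EuclideanSpace ℝ ι)} (hW : IsOpen W) {a : EuclideanSpace ℝ ι} (ha : a ∈ W)
    {t : ι → EuclideanSpace ℝ ι → ℝ} (ht : ∀ k, ContDiffOn ℝ ∞ (t k) W)
    (hsymm : ∀ z ∈ W, ∀ j k, fderiv ℝ (t k) z (EuclideanSpace.basisFun ι ℝ j) =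
      fderiv ℝ (t j) z (EuclideanSpace.basisFun ι ℝ k)) :
    ∃ B ⊆ W, IsOpen B ∧ a ∈ B ∧ ∃ f : EuclideanSpace ℝ ι → ℝ, ContDiffOn ℝ ∞ f B ∧
      ∀ z ∈ B, HasFDerivAt f
        (∑ k, t k z • (EuclideanSpace.proj k : EuclideanSpace ℝ ι →L[ℝ] ℝ)) z := by
  classical
  refine exists_contDiffOn_hasFDerivAt hW ha
    (ContDiffOn.sum fun k _ ↦ (ht k).smul contDiffOn_const) fun z hz ↦ ?_
  have hderiv := HasFDerivAt.fun_sum (u := Finset.univ) fun k _ ↦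
    (((ht k).contDiffAt (hW.mem_nhds hz)).differentiableAt (by simp)).hasFDerivAt.smul_const
      (EuclideanSpace.proj k : EuclideanSpace ℝ ι →L[ℝ] ℝ)
  let D : LinearMap.BilinForm ℝ (EuclideanSpace ℝ ι) := ContinuousLinearMap.coeLM ℝ ∘ₗ
    (fderiv ℝ (fun z ↦ ∑ k, t k z • (EuclideanSpace.proj k : EuclideanSpace ℝ ι →L[ℝ] ℝ)) z)
  have hbasis (j k) : D (EuclideanSpace.basisFun ι ℝ j) (EuclideanSpace.basisFun ι ℝ k) =
      fderiv ℝ (t k) z (EuclideanSpace.basisFun ι ℝ j) := by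
    simp [D, hderiv.fderiv]
  have hD : D.IsSymm := (LinearMap.BilinForm.isSymm_iff_basis
    (EuclideanSpace.basisFun ι ℝ).toBasis).2 fun j k ↦ by
      simp only [OrthonormalBasis.coe_toBasis, hbasis, hsymm z hz j k]
  exact fun u v ↦ hD.eq u v

section StatisticalManifold

variable {n : ℕ} {M : Type*} [TopologicalSpace M] [ChartedSpace (EuclideanSpace ℝ (Fin n)) M]
  [IsManifold (𝓡 n) ∞ M]

/-! ### Curvature of dual connections -/

theorem exists_smoothVectorField_eventuallyEq [T2Space M] {U : Set M} (hU : IsOpen U)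
    {σ : ∀ x : M, TangentSpace (𝓡 n) x} (hσ : IsSmoothFieldOn U σ) {x : M} (hx : x ∈ U) :
    ∃ Z : SmoothVectorField n M, Z =ᶠ[nhds x] σ := by
  obtain ⟨f, -, hfU⟩ :=
    (SmoothBumpFunction.nhds_basis_tsupport (I := 𝓡 n) x).mem_iff.1 (hU.mem_nhds hx)
  refine ⟨⟨fun y ↦ f y • σ y, f.contMDiff.contMDiffOn.smul_section_of_tsupport hU hfU hσ⟩, ?_⟩
  filter_upwards [f.eventuallyEq_one] with y hy
  change f y • σ y = σ y
  rw [hy, Pi.one_apply, one_smul]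

theorem exists_smoothVectorField_apply_eq [T2Space M] {x : M} (v : TangentSpace (𝓡 n) x) :
    ∃ Z : SmoothVectorField n M, Z x = v := by
  obtain ⟨s, hs, hsmooth⟩ := FiberBundle.exists_contMDiffOn_extend (k := ∞) (𝓡 n)
    (EuclideanSpace ℝ (Fin n)) v
  obtain ⟨Z, hZ⟩ := exists_smoothVectorField_eventuallyEq isOpen_interior
    (hsmooth.mono interior_subset) (mem_interior_iff_mem_nhds.2 hs)
  exact ⟨Z, hZ.eq_of_nhds.trans (FiberBundle.extend_apply_self _ v)⟩

namespace SmoothVectorField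

/-- The Lie bracket of smooth vector fields, bundled as a smooth vector field. -/
def bracket (X Y : SmoothVectorField n M) : SmoothVectorField n M where
  toFun := VectorField.mlieBracket (𝓡 n) X Y
  contMDiff_toFun := by
    have : IsManifold (𝓡 n) (minSmoothness ℝ 2) M :=
      .of_le (n := ∞) (by simpa using ENat.LEInfty.out)
    have : IsManifold (𝓡 n) ((⊤ : ℕ∞) + 1) M := ‹IsManifold (𝓡 n) ∞ M›
    exact ContDiff.mlieBracket_vectorField (n := ⊤) (m := ⊤) X.contMDiff Y.contMDiff (by simp)

@[simp]
theorem bracket_apply (X Y : SmoothVectorField n M) (x : M) :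
    bracket X Y x = VectorField.mlieBracket (𝓡 n) X Y x := rfl

theorem bracket_swap (X Y : SmoothVectorField n M) : bracket X Y = -bracket Y X :=
  ContMDiffSection.ext fun _ ↦ VectorField.mlieBracket_swap_apply

theorem bracket_neg (X Y : SmoothVectorField n M) : bracket X (-Y) = -bracket X Y := by
  have : IsManifold (𝓡 n) 2 M := .of_le (n := ∞) ENat.LEInfty.out
  ext1 x
  have := VectorField.mlieBracket_const_smul_right (I := 𝓡 n) (c := (-1 : ℝ)) (V := X) (W := Y)
    (x := x) Y.mdifferentiableAt
  simpa using this

theorem jacobi (X Y Z : SmoothVectorField n M) :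
    bracket X (bracket Y Z) + bracket Y (bracket Z X) + bracket Z (bracket X Y) = 0 := by
  have : IsManifold (𝓡 n) (minSmoothness ℝ 3) M :=
    .of_le (n := ∞) (by simpa using ENat.LEInfty.out)
  have hC2 (W : SmoothVectorField n M) := W.contMDiff.of_le
    (show minSmoothness ℝ 2 ≤ ∞ by simpa using ENat.LEInfty.out)
  have hleib : bracket X (bracket Y Z) = bracket (bracket X Y) Z + bracket Y (bracket X Z) :=
    ContMDiffSection.coe_inj
      (VectorField.leibniz_identity_mlieBracket (hC2 X) (hC2 Y) (hC2 Z))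
  rw [hleib, bracket_swap (bracket X Y) Z, bracket_swap X Z, bracket_neg]
  abel

end SmoothVectorField

theorem contMDiff_inner (g : SmoothMetric n M) (Y Z : SmoothVectorField n M) :
    ContMDiff (𝓡 n) 𝓘(ℝ, ℝ) ∞ (fun y ↦ g.inner y (Y y) (Z y)) := by
  let : RiemannianBundle (fun x : M ↦ TangentSpace (𝓡 n) x) := ⟨g.toRiemannianMetric⟩
  exact ContMDiff.inner_bundle (F := EuclideanSpace ℝ (Fin n))
    (E := fun x : M ↦ TangentSpace (𝓡 n) x) Y.contMDiff Z.contMDiff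

theorem eq_of_forall_inner_eq [T2Space M] (g : SmoothMetric n M) {x : M}
    {v w : TangentSpace (𝓡 n) x}
    (h : ∀ Y : SmoothVectorField n M, g.inner x (Y x) v = g.inner x (Y x) w) : v = w := by
  obtain ⟨Y, hY⟩ := exists_smoothVectorField_apply_eq (v - w)
  by_contra hne
  have hpos := g.pos x (v - w) (sub_ne_zero.2 hne)
  rw [map_sub, ← hY, h Y, sub_self] at hpos
  exact lt_irrefl _ hpos

theorem exists_basis_inner_eq_repr_mul (g : SmoothMetric n M) (x : M) :
    ∃ b : Module.Basis (Fin (Module.finrank ℝ (TangentSpace (𝓡 n) x))) ℝ (TangentSpace (𝓡 n) x),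
      ∀ v i, g.inner x v (b i) = b.repr v i * g.inner x (b i) (b i) := by
  let B : LinearMap.BilinForm ℝ (TangentSpace (𝓡 n) x) :=
    ContinuousLinearMap.coeLM ℝ ∘ₗ (g.inner x).toLinearMap
  have hB : LinearMap.IsSymm B := ⟨fun v w ↦ g.symm x v w⟩
  have : FiniteDimensional ℝ (TangentSpace (𝓡 n) x) :=
    Module.Finite.of_basis (EuclideanSpace.basisFun (Fin n) ℝ).toBasis
  obtain ⟨b, hb⟩ := LinearMap.BilinForm.exists_orthogonal_basis hB
  refine ⟨b, fun v i ↦ ?_⟩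
  have horth (j) (hj : j ≠ i) : g.inner x (b j) (b i) = 0 := hb hj
  conv_lhs => rw [← b.sum_repr v]
  simp only [map_sum, map_smul, sum_apply, smul_apply, smul_eq_mul]
  exact Finset.sum_eq_single i (fun j _ hj ↦ by rw [horth j hj, mul_zero]) (by simp)

namespace AffineConnection

open SmoothVectorField

section Smooth

variable (nab : AffineConnection n M) [CovariantDerivative.ContMDiffCovariantDerivative nab ∞]

/-- The vector field `∇_X Z`, bundled as a smooth vector field. -/
def covField (X Z : SmoothVectorField n M) : SmoothVectorField n M where
  toFun y := nab Z y (X y)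
  contMDiff_toFun :=
    have hZ := CovariantDerivative.ContMDiffCovariantDerivative.contMDiff (cov := nab) (k := ∞)
      |>.contMDiff (σ := Z) (by simpa using! Z.contMDiff.contMDiffOn)
    (contMDiffOn_univ.1 hZ).clm_bundle_apply X.contMDiff

@[simp]
theorem covField_apply (X Z : SmoothVectorField n M) (x : M) :
    covField nab X Z x = nab Z x (X x) := rfl

theorem curvature_eq (X Y Z : SmoothVectorField n M) (x : M) :
    curvature nab Z x (X x) (Y x) = covField nab X (covField nab Y Z) x
      - covField nab Y (covField nab X Z) x - covField nab (bracket X Y) Z x :=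
  curvature_apply nab Z X.mdifferentiableAt Y.mdifferentiableAt

theorem curvature_swap (X Y Z : SmoothVectorField n M) (x : M) :
    curvature nab Z x (X x) (Y x) = -curvature nab Z x (Y x) (X x) := by
  rw [curvature_eq, curvature_eq]
  exact curvatureAux_swap nab Z X Y x

end Smooth

variable {nab nabS : AffineConnection n M} {g : SmoothMetric n M}

theorem nab_sub (X Y : SmoothVectorField n M) (x : M) : nab ⇑(X - Y) x = nab X x - nab Y x := by
  rw [eq_sub_iff_add_eq, ← nab.isCovariantDerivativeOn.add (s := Set.univ)
    (X - Y).mdifferentiableAt Y.mdifferentiableAt, ContMDiffSection.coe_sub, sub_add_cancel]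

theorem nab_sub_nab_of_torsion_eq_zero (h : CovariantDerivative.torsion nab = 0)
    (X Y : SmoothVectorField n M) (x : M) : nab Y x (X x) - nab X x (Y x) = bracket X Y x :=
  nab.torsion_eq_zero_iff.1 h X.mdifferentiableAt Y.mdifferentiableAt

theorem torsion_eq_zero_of_forall [T2Space M]
    (h : ∀ (X Y : SmoothVectorField n M) (x : M), nab Y x (X x) - nab X x (Y x) = bracket X Y x) :
    CovariantDerivative.torsion nab = 0 := by
  ext x u v
  obtain ⟨X, rfl⟩ := exists_smoothVectorField_apply_eq u
  obtain ⟨Y, rfl⟩ := exists_smoothVectorField_apply_eq v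
  rw [CovariantDerivative.torsion_apply _ X.mdifferentiableAt Y.mdifferentiableAt, h]
  exact sub_self _

theorem IsStatistical.torsion_dual_eq_zero [T2Space M] (h : IsStatistical g nab)
    (hd : IsDual g nab nabS) : CovariantDerivative.torsion nabS = 0 := by
  refine torsion_eq_zero_of_forall fun X Z x ↦ eq_of_forall_inner_eq g fun Y ↦ ?_
  have hcubic : cubicForm g nab X Y Z x = cubicForm g nab Z Y X x := by
    rw [h.symm_right X, h.symm_left X, h.symm_right Z]
  simp only [cubicForm, hd X Y Z x, hd Z Y X x] at hcubic
  rw [← nab_sub_nab_of_torsion_eq_zero h.torsion_free, map_sub, map_sub]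
  linarith

variable [CovariantDerivative.ContMDiffCovariantDerivative nab ∞]
  [CovariantDerivative.ContMDiffCovariantDerivative nabS ∞]

theorem bianchi (h : CovariantDerivative.torsion nab = 0) (X Y Z : SmoothVectorField n M) (x : M) :
    curvature nab Z x (X x) (Y x) + curvature nab X x (Y x) (Z x)
      + curvature nab Y x (Z x) (X x) = 0 := by
  have hbracket (A B : SmoothVectorField n M) : bracket A B = covField nab A B - covField nab B A :=
    ContMDiffSection.ext fun y ↦ (nab_sub_nab_of_torsion_eq_zero h A B y).symm
  have hbracket₂ (A B C : SmoothVectorField n M) :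
      bracket A (bracket B C) x = covField nab A (covField nab B C) x
        - covField nab A (covField nab C B) x - covField nab (bracket B C) A x := by
    rw [← nab_sub_nab_of_torsion_eq_zero h, covField_apply nab (bracket B C)]
    simp only [hbracket B C, nab_sub, sub_apply, covField_apply]
  have hjacobi := congrArg (fun W : SmoothVectorField n M ↦ W x) (jacobi X Y Z)
  simp only [ContMDiffSection.coe_add, Pi.add_apply, hbracket₂] at hjacobi
  rw [curvature_eq, curvature_eq, curvature_eq]
  refine Eq.trans ?_ hjacobi
  abel

theorem IsDual.inner_curvature (hd : IsDual g nab nabS) (X Y Z W : SmoothVectorField n M) (x : M) :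
    g.inner x (curvature nab Z x (X x) (Y x)) (W x) =
      -g.inner x (Z x) (curvature nabS W x (X x) (Y x)) := by
  have : IsManifold (𝓡 n) 3 M := .of_le (n := ∞) ENat.LEInfty.out
  have hdiff (A B : SmoothVectorField n M) :
      MDifferentiableAt (𝓡 n) 𝓘(ℝ, ℝ) (fun y ↦ g.inner y (A y) (B y)) x :=
    (contMDiff_inner g A B x).mdifferentiableAt (by simp)
  have hsecond (A B : SmoothVectorField n M) :
      mvfderiv (𝓡 n) (fun y ↦ mvfderiv (𝓡 n) (fun y ↦ g.inner y (Z y) (W y)) y (B y)) x (A x) =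
        g.inner x (covField nab A (covField nab B Z) x) (W x)
          + g.inner x (covField nab B Z x) (covField nabS A W x)
          + (g.inner x (covField nab A Z x) (covField nabS B W x)
            + g.inner x (Z x) (covField nabS A (covField nabS B W) x)) := by
    have hfirst : (fun y ↦ mvfderiv (𝓡 n) (fun y ↦ g.inner y (Z y) (W y)) y (B y)) =
        (fun y ↦ g.inner y (covField nab B Z y) (W y)) +
          (fun y ↦ g.inner y (Z y) (covField nabS B W y)) := funext (hd B Z W)
    rw [hfirst, mvfderiv_add (hdiff _ _) (hdiff _ _), add_apply, hd A, hd A]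
    rfl
  have hcomm := mvfderiv_mlieBracket ((contMDiff_inner g Z W x).of_le ENat.LEInfty.out)
    (X.contMDiff.contMDiffAt.of_le ENat.LEInfty.out)
    (Y.contMDiff.contMDiffAt.of_le ENat.LEInfty.out)
  rw [hsecond, hsecond, ← bracket_apply, hd (bracket X Y)] at hcomm
  rw [curvature_eq, curvature_eq]
  simp only [map_sub, sub_apply, covField_apply] at hcomm ⊢
  linarith

section Ricci

variable {x : M} {ι : Type*} [Fintype ι] (b : Module.Basis ι ℝ (TangentSpace (𝓡 n) x))
  {F : ι → SmoothVectorField n M}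

theorem ricci_eq_sum_repr (hF : ∀ i, F i x = b i) (Y Z : SmoothVectorField n M) :
    ricci nab Y Z x = ∑ i, b.repr (curvature nab Z x (F i x) (Y x)) i := by
  classical
  rw [ricci, LinearMap.trace_eq_matrix_trace ℝ b]
  simp only [Matrix.trace, Matrix.diag, LinearMap.toMatrix_apply, hF]
  rfl

theorem ricci_sub_ricci (h : CovariantDerivative.torsion nab = 0) (hF : ∀ i, F i x = b i)
    (Y Z : SmoothVectorField n M) :
    ricci nab Y Z x - ricci nab Z Y x = -∑ i, b.repr (curvature nab (F i) x (Y x) (Z x)) i := by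
  rw [ricci_eq_sum_repr b hF, ricci_eq_sum_repr b hF, ← Finset.sum_sub_distrib,
    ← Finset.sum_neg_distrib]
  refine Finset.sum_congr rfl fun i _ ↦ ?_
  have hbianchi : curvature nab Z x (F i x) (Y x) - curvature nab Y x (F i x) (Z x) =
      -curvature nab (F i) x (Y x) (Z x) := by
    rw [eq_neg_iff_add_eq_zero, ← bianchi h (F i) Y Z x, curvature_swap nab Z (F i) Y]
    abel
  rw [← Finsupp.sub_apply, ← map_sub, hbianchi, map_neg, Finsupp.neg_apply]

end Ricci

theorem IsDual.ricci_sub_ricci [T2Space M] (hd : IsDual g nab nabS)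
    (h : CovariantDerivative.torsion nab = 0) (hS : CovariantDerivative.torsion nabS = 0)
    (Y Z : SmoothVectorField n M) (x : M) :
    ricci nab Y Z x - ricci nab Z Y x = -(ricci nabS Y Z x - ricci nabS Z Y x) := by
  obtain ⟨b, hb⟩ := exists_basis_inner_eq_repr_mul g x
  choose F hF using fun i ↦ exists_smoothVectorField_apply_eq (b i)
  have hrepr (i) : b.repr (curvature nab (F i) x (Y x) (Z x)) i =
      -b.repr (curvature nabS (F i) x (Y x) (Z x)) i := by
    have hinner := hd.inner_curvature Y Z (F i) (F i) x
    rw [g.symm x (F i x), hF, hb (curvature nab _ _ _ _), hb (curvature nabS _ _ _ _),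
      ← neg_mul] at hinner
    exact mul_right_cancel₀ (g.pos x (b i) (b.ne_zero i)).ne' hinner
  rw [AffineConnection.ricci_sub_ricci b h hF, AffineConnection.ricci_sub_ricci b hS hF]
  simp only [hrepr, Finset.sum_neg_distrib]

theorem IsConjugateRicciSymmetric.isRicciSymmetric [T2Space M]
    (hRic : IsConjugateRicciSymmetric nab nabS) (hd : IsDual g nab nabS)
    (h : CovariantDerivative.torsion nab = 0) (hS : CovariantDerivative.torsion nabS = 0) :
    IsRicciSymmetric nab := fun Y Z x ↦ by
  have hskew := hd.ricci_sub_ricci h hS Y Z x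
  rw [← hRic Y Z x, ← hRic Z Y x] at hskew
  linarith

end AffineConnection

/-! ### Coordinate frames -/

/-- The trivialization of the tangent bundle induced by the preferred chart at `p`. -/
abbrev chartTriv (p : M) : Trivialization (EuclideanSpace ℝ (Fin n))
    (TotalSpace.proj :
      TotalSpace (EuclideanSpace ℝ (Fin n)) (TangentSpace (𝓡 n) : M → Type _) → M) :=
  trivializationAt (EuclideanSpace ℝ (Fin n)) (TangentSpace (𝓡 n)) p

/-- The coordinate vector field `∂ᵢ` of the preferred chart at `p`; outside the domain of the chart
it is zero. -/
abbrev coordFrame (p : M) (i : Fin n) (x : M) : TangentSpace (𝓡 n) x :=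
  (chartTriv p).localFrame (EuclideanSpace.basisFun (Fin n) ℝ).toBasis i x

/-- The coordinate differential `dxᵢ` of the preferred chart at `p`; outside the domain of the chart
it is zero. -/
abbrev coordCoeff (p : M) (i : Fin n) (x : M) : TangentSpace (𝓡 n) x →ₗ[ℝ] ℝ :=
  (chartTriv p).localFrameCoeff (𝓡 n) (EuclideanSpace.basisFun (Fin n) ℝ).toBasis i x

section CoordFrame

theorem isSmoothFieldOn_coordFrame (p : M) (i : Fin n) :
    IsSmoothFieldOn (chartAt (EuclideanSpace ℝ (Fin n)) p).source (coordFrame p i) :=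
  (chartTriv p).contMDiffOn_localFrame_baseSet ∞ _ i

variable {p x : M}

theorem coordCoeff_eq_repr_basisAt (hx : x ∈ (chartTriv (n := n) p).baseSet) (i : Fin n)
    (v : TangentSpace (𝓡 n) x) : coordCoeff p i x v =
      ((chartTriv p).basisAt (EuclideanSpace.basisFun (Fin n) ℝ).toBasis hx).repr v i := by
  classical
  simpa using (chartTriv p).localFrameCoeff_apply_of_mem_baseSet (I := 𝓡 n)
    (b := (EuclideanSpace.basisFun (Fin n) ℝ).toBasis) hx (Function.update 0 x v) i

theorem coordFrame_eq_basisAt (hx : x ∈ (chartTriv (n := n) p).baseSet) (i : Fin n) :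
    coordFrame p i x = (chartTriv p).basisAt (EuclideanSpace.basisFun (Fin n) ℝ).toBasis hx i :=
  (chartTriv p).localFrame_apply_of_mem_baseSet _ hx

theorem contMDiffOn_coordCoeff {U : Set M} (hU : IsOpen U)
    (hUs : U ⊆ (chartAt (EuclideanSpace ℝ (Fin n)) p).source)
    {Y : ∀ x : M, TangentSpace (𝓡 n) x} (hY : IsSmoothFieldOn U Y) (i : Fin n) :
    ContMDiffOn (𝓡 n) 𝓘(ℝ, ℝ) ∞ (fun x ↦ coordCoeff p i x (Y x)) U :=
  contMDiffOn_localFrameCoeff (e := chartTriv p) (EuclideanSpace.basisFun (Fin n) ℝ).toBasis hU hUs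
    hY i

variable (hx : x ∈ (chartAt (EuclideanSpace ℝ (Fin n)) p).source)
include hx

theorem sum_coordCoeff_smul_coordFrame (v : TangentSpace (𝓡 n) x) :
    ∑ i, coordCoeff p i x v • coordFrame p i x = v := by
  simp only [coordCoeff_eq_repr_basisAt hx, coordFrame_eq_basisAt hx, Module.Basis.sum_repr]

theorem coordCoeff_coordFrame (i j : Fin n) :
    coordCoeff p i x (coordFrame p j x) = if i = j then 1 else 0 := by
  simp only [coordCoeff_eq_repr_basisAt hx, coordFrame_eq_basisAt hx, Module.Basis.repr_self,
    Finsupp.single_apply, eq_comm]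

theorem mfderiv_extChartAt_coordFrame (i : Fin n) :
    mfderiv (𝓡 n) 𝓘(ℝ, EuclideanSpace ℝ (Fin n)) (extChartAt (𝓡 n) p) x (coordFrame p i x) =
      EuclideanSpace.basisFun (Fin n) ℝ i := by
  have : IsManifold (𝓡 n) 1 M := .of_le (n := ∞) ENat.LEInfty.out
  have hx' : x ∈ (chartTriv (n := n) p).baseSet := hx
  have htriv : (chartTriv p).continuousLinearMapAt ℝ x (coordFrame p i x) =
      EuclideanSpace.basisFun (Fin n) ℝ i := by
    rw [coordFrame_eq_basisAt hx', Trivialization.basisAt,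
      Trivialization.continuousLinearMapAt_apply, Trivialization.linearMapAt_def_of_mem _ hx']
    exact (((chartTriv p).linearEquivAt ℝ x hx').apply_symm_apply _).trans (by simp)
  rw [← htriv]
  exact congrArg (fun L : TangentSpace (𝓡 n) x →L[ℝ] EuclideanSpace ℝ (Fin n) ↦
    L (coordFrame p i x)) (TangentBundle.continuousLinearMapAt_trivializationAt hx).symm

theorem mdifferentiableAt_coordCoeff {Y : ∀ x : M, TangentSpace (𝓡 n) x}
    (hY : AffineConnection.IsDiffFieldAt Y x) (i : Fin n) :
    MDifferentiableAt (𝓡 n) 𝓘(ℝ, ℝ) (fun x ↦ coordCoeff p i x (Y x)) x :=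
  mdifferentiableAt_localFrameCoeff (e := chartTriv p) (EuclideanSpace.basisFun (Fin n) ℝ).toBasis
    hx hY i

end CoordFrame

/-- The vector field on `ℝⁿ` with constant value `v`, as a section of the tangent bundle. -/
def constField (v z : EuclideanSpace ℝ (Fin n)) :
    TangentSpace 𝓘(ℝ, EuclideanSpace ℝ (Fin n)) z := v

theorem mlieBracket_constField (v w z : EuclideanSpace ℝ (Fin n)) :
    VectorField.mlieBracket 𝓘(ℝ, EuclideanSpace ℝ (Fin n)) (constField v) (constField w) z = 0 := by
  rw [← VectorField.mlieBracketWithin_univ, VectorField.mlieBracketWithin_eq_lieBracketWithin]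
  change VectorField.lieBracketWithin ℝ (fun _ ↦ v) (fun _ ↦ w) Set.univ z = 0
  simp [VectorField.lieBracketWithin]

theorem isDiffFieldAt_constField (v z : EuclideanSpace ℝ (Fin n)) :
    AffineConnection.IsDiffFieldAt (constField v) z :=
  (contMDiffAt_vectorSpace_iff_contDiffAt.2
    (contDiffAt_const (n := 1) (c := v) (x := z))).mdifferentiableAt one_ne_zero

theorem coordFrame_eq_mpullback {p x : M}
    (hx : x ∈ (chartAt (EuclideanSpace ℝ (Fin n)) p).source) (i : Fin n) :
    coordFrame p i x = VectorField.mpullback (𝓡 n) 𝓘(ℝ, EuclideanSpace ℝ (Fin n))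
      (extChartAt (𝓡 n) p) (constField (EuclideanSpace.basisFun (Fin n) ℝ i)) x := by
  have : IsManifold (𝓡 n) 1 M := .of_le (n := ∞) ENat.LEInfty.out
  have hinv := isInvertible_mfderiv_extChartAt (I := 𝓡 n) (x := p) (y := x) (by simpa using hx)
  rw [VectorField.mpullback_apply, eq_comm, hinv.inverse_apply_eq]
  exact (mfderiv_extChartAt_coordFrame hx i).symm

theorem mlieBracket_coordFrame {p x : M}
    (hx : x ∈ (chartAt (EuclideanSpace ℝ (Fin n)) p).source) (i j : Fin n) :
    VectorField.mlieBracket (𝓡 n) (coordFrame p i) (coordFrame p j) x = 0 := by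
  have : IsManifold (𝓡 n) 1 M := .of_le (n := ∞) ENat.LEInfty.out
  have : IsManifold (𝓡 n) (minSmoothness ℝ 2) M :=
    .of_le (n := ∞) (by simpa using ENat.LEInfty.out)
  have : IsManifold (𝓡 n) (minSmoothness ℝ 3) M :=
    .of_le (n := ∞) (by simpa using ENat.LEInfty.out)
  have hpullback (k : Fin n) : coordFrame p k =ᶠ[nhds x]
      VectorField.mpullback (𝓡 n) 𝓘(ℝ, EuclideanSpace ℝ (Fin n)) (extChartAt (𝓡 n) p)
        (constField (EuclideanSpace.basisFun (Fin n) ℝ k)) :=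
    Filter.eventually_of_mem ((chartAt _ p).open_source.mem_nhds hx)
      fun y hy ↦ coordFrame_eq_mpullback hy k
  rw [(hpullback i).mlieBracket_vectorField_eq (hpullback j),
    ← VectorField.mpullback_mlieBracket (isDiffFieldAt_constField _ _)
      (isDiffFieldAt_constField _ _) (contMDiffAt_extChartAt' (n := ∞) hx)
      (by simpa using ENat.LEInfty.out),
    VectorField.mpullback_apply, mlieBracket_constField, map_zero]

/-! ### The trace of the connection form -/

namespace AffineConnection

variable (nab : AffineConnection n M)

section Locality

variable {σ τ : ∀ x : M, TangentSpace (𝓡 n) x} {x : M}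

theorem IsDiffFieldAt.congr (hτ : IsDiffFieldAt τ x) (h : σ =ᶠ[nhds x] τ) : IsDiffFieldAt σ x :=
  hτ.congr_of_eventuallyEq (h.mono fun _ hy ↦ congrArg _ hy)

theorem nab_congr (hτ : IsDiffFieldAt τ x) (h : σ =ᶠ[nhds x] τ) : nab σ x = nab τ x :=
  nab.isCovariantDerivativeOn.congr_of_eventuallyEq (s := Set.univ) (hτ.congr h) hτ
    Filter.univ_mem h

theorem curvatureAux_congr [CovariantDerivative.ContMDiffCovariantDerivative nab ∞]
    {Z : SmoothVectorField n M} (h : σ =ᶠ[nhds x] Z) {X Y : ∀ x : M, TangentSpace (𝓡 n) x}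
    (hX : IsDiffFieldAt X x) (hY : IsDiffFieldAt Y x) :
    curvatureAux nab σ X Y x = curvatureAux nab Z X Y x := by
  have hnab (W : ∀ x : M, TangentSpace (𝓡 n) x) :
      (fun y ↦ nab σ y (W y)) =ᶠ[nhds x] fun y ↦ nab Z y (W y) :=
    h.eventuallyEq_nhds.mono fun y hy ↦
      congrArg (fun L : TangentSpace (𝓡 n) y →L[ℝ] TangentSpace (𝓡 n) y ↦ L (W y))
        (nab_congr nab Z.mdifferentiableAt hy)
  rw [curvatureAux, curvatureAux, nab_congr nab (mdifferentiableAt_nab nab Z hY) (hnab Y),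
    nab_congr nab (mdifferentiableAt_nab nab Z hX) (hnab X), nab_congr nab Z.mdifferentiableAt h]

theorem isSmoothFieldOn_nab [T2Space M] [CovariantDerivative.ContMDiffCovariantDerivative nab ∞]
    {U : Set M} (hU : IsOpen U) {X : ∀ x : M, TangentSpace (𝓡 n) x} (hσ : IsSmoothFieldOn U σ)
    (hX : IsSmoothFieldOn U X) : IsSmoothFieldOn U (fun y ↦ nab σ y (X y)) := fun x hx ↦ by
  obtain ⟨Z, hZ⟩ := exists_smoothVectorField_eventuallyEq hU hσ hx
  obtain ⟨X', hX'⟩ := exists_smoothVectorField_eventuallyEq hU hX hx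
  have hlocal : (fun y ↦ nab σ y (X y)) =ᶠ[nhds x] covField nab X' Z := by
    filter_upwards [hZ.symm.eventuallyEq_nhds, hX'] with y hZy hXy
    rw [covField_apply, nab_congr nab Z.mdifferentiableAt hZy, hXy]
  exact ((covField nab X' Z).contMDiff.contMDiffAt.congr_of_eventuallyEq
    (hlocal.mono fun _ hy ↦ congrArg _ hy)).contMDiffWithinAt

end Locality

theorem nab_fun_sum {ι : Type*} {s : Finset ι} {σ : ι → ∀ x : M, TangentSpace (𝓡 n) x} {x : M}
    (hσ : ∀ i ∈ s, IsDiffFieldAt (σ i) x) :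
    nab (fun y ↦ ∑ i ∈ s, σ i y) x = ∑ i ∈ s, nab (σ i) x := by
  classical
  induction s using Finset.induction_on with
  | empty =>
    simp only [Finset.sum_empty]
    exact congrFun nab.zero x
  | insert a s ha ih =>
    have hs : IsDiffFieldAt (fun y ↦ ∑ i ∈ s, σ i y) x :=
      MDifferentiableAt.sum_section fun i hi ↦ hσ i (Finset.mem_insert_of_mem hi)
    simp only [Finset.sum_insert ha]
    rw [← ih fun i hi ↦ hσ i (Finset.mem_insert_of_mem hi)]
    exact nab.isCovariantDerivativeOn.add (s := Set.univ) (hσ a (Finset.mem_insert_self a s)) hs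

/-- The connection form of `∇` in the coordinate frame of the preferred chart at `p`. Row `i` of the
matrix lists the components of `∇_v ∂ᵢ`, so that coordinates of vectors are to be read as rows. -/
def connectionForm (p x : M) : TangentSpace (𝓡 n) x →ₗ[ℝ] Matrix (Fin n) (Fin n) ℝ where
  toFun v := .of fun i j ↦ coordCoeff p j x (nab (coordFrame p i) x v)
  map_add' v w := by ext; simp
  map_smul' c v := by ext; simp

theorem connectionForm_apply (p x : M) (v : TangentSpace (𝓡 n) x) (i j : Fin n) :
    connectionForm nab p x v i j = coordCoeff p j x (nab (coordFrame p i) x v) := rfl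

/-- The trace of the connection form: the connection form of the determinant bundle in the frame
`dx₁ ∧ ⋯ ∧ dxₙ`, up to sign. -/
def traceForm (p x : M) : TangentSpace (𝓡 n) x →ₗ[ℝ] ℝ :=
  Matrix.traceLinearMap (Fin n) ℝ ℝ ∘ₗ connectionForm nab p x

theorem traceForm_apply (p x : M) (v : TangentSpace (𝓡 n) x) :
    traceForm nab p x v = ∑ i, connectionForm nab p x v i i := rfl

variable {p x : M}

theorem coordCoeff_nab (hx : x ∈ (chartAt (EuclideanSpace ℝ (Fin n)) p).source)
    {σ : ∀ x : M, TangentSpace (𝓡 n) x} (hσ : IsDiffFieldAt σ x) (v : TangentSpace (𝓡 n) x)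
    (j : Fin n) :
    coordCoeff p j x (nab σ x v) = mvfderiv (𝓡 n) (fun y ↦ coordCoeff p j y (σ y)) x v
      + ∑ i, coordCoeff p i x (σ x) * connectionForm nab p x v i j := by
  have hcoeff (i : Fin n) := mdifferentiableAt_coordCoeff hx hσ i
  have hframe (i : Fin n) : IsDiffFieldAt (coordFrame p i) x :=
    ((isSmoothFieldOn_coordFrame p i).contMDiffAt
      ((chartAt _ p).open_source.mem_nhds hx)).mdifferentiableAt (by simp)
  have hterm (i : Fin n) : IsDiffFieldAt ((fun y ↦ coordCoeff p i y (σ y)) • coordFrame p i) x :=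
    (hcoeff i).smul_section (hframe i)
  have hexpand : σ =ᶠ[nhds x] fun y ↦ ∑ i, ((fun y ↦ coordCoeff p i y (σ y)) • coordFrame p i) y :=
    Filter.eventually_of_mem ((chartAt _ p).open_source.mem_nhds hx) fun y hy ↦
      (sum_coordCoeff_smul_coordFrame hy (σ y)).symm
  have hleib (i : Fin n) : coordCoeff p j x
      (nab ((fun y ↦ coordCoeff p i y (σ y)) • coordFrame p i) x v) =
        (if j = i then mvfderiv (𝓡 n) (fun y ↦ coordCoeff p i y (σ y)) x v else 0)
          + coordCoeff p i x (σ x) * connectionForm nab p x v i j := by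
    rw [nab.isCovariantDerivativeOn.leibniz (s := Set.univ) (hframe i) (hcoeff i)]
    simp [coordCoeff_coordFrame hx, connectionForm_apply, add_comm]
  rw [nab_congr nab (MDifferentiableAt.sum_section fun i _ ↦ hterm i) hexpand,
    nab_fun_sum nab fun i _ ↦ hterm i, sum_apply, map_sum, Finset.sum_congr rfl fun i _ ↦ hleib i,
    Finset.sum_add_distrib, Finset.sum_ite_eq, if_pos (Finset.mem_univ j)]

variable [T2Space M] [CovariantDerivative.ContMDiffCovariantDerivative nab ∞] {U : Set M}

theorem contMDiffOn_connectionForm (hU : IsOpen U)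
    (hUs : U ⊆ (chartAt (EuclideanSpace ℝ (Fin n)) p).source) {X : ∀ x : M, TangentSpace (𝓡 n) x}
    (hX : IsSmoothFieldOn U X) (i j : Fin n) :
    ContMDiffOn (𝓡 n) 𝓘(ℝ, ℝ) ∞ (fun y ↦ connectionForm nab p y (X y) i j) U :=
  contMDiffOn_coordCoeff hU hUs
    (isSmoothFieldOn_nab nab hU ((isSmoothFieldOn_coordFrame p i).mono hUs) hX) j

theorem contMDiffOn_traceForm (hU : IsOpen U)
    (hUs : U ⊆ (chartAt (EuclideanSpace ℝ (Fin n)) p).source) {X : ∀ x : M, TangentSpace (𝓡 n) x}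
    (hX : IsSmoothFieldOn U X) :
    ContMDiffOn (𝓡 n) 𝓘(ℝ, ℝ) ∞ (fun y ↦ traceForm nab p y (X y)) U := by
  simp only [traceForm_apply]
  exact contMDiffOn_finsetSum fun i _ ↦ contMDiffOn_connectionForm nab hU hUs hX i i

section Trace

variable (hU : IsOpen U) (hUs : U ⊆ (chartAt (EuclideanSpace ℝ (Fin n)) p).source) (hx : x ∈ U)
  {X Y : ∀ x : M, TangentSpace (𝓡 n) x} (hX : IsSmoothFieldOn U X) (hY : IsSmoothFieldOn U Y)
include hU hUs hx hY

theorem sum_coordCoeff_nab_nab_coordFrame (v : TangentSpace (𝓡 n) x) :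
    ∑ i, coordCoeff p i x (nab (fun y ↦ nab (coordFrame p i) y (Y y)) x v) =
      mvfderiv (𝓡 n) (fun y ↦ traceForm nab p y (Y y)) x v
        + (connectionForm nab p x (Y x) * connectionForm nab p x v).trace := by
  have hentry (i : Fin n) : MDifferentiableAt (𝓡 n) 𝓘(ℝ, ℝ)
      (fun y ↦ connectionForm nab p y (Y y) i i) x :=
    ((contMDiffOn_connectionForm nab hU hUs hY i i).contMDiffAt
      (hU.mem_nhds hx)).mdifferentiableAt (by simp)
  have hderiv : mvfderiv (𝓡 n) (fun y ↦ traceForm nab p y (Y y)) x =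
      ∑ i, mvfderiv (𝓡 n) (fun y ↦ connectionForm nab p y (Y y) i i) x := by
    simp only [traceForm_apply]
    exact mvfderiv_fun_sum fun i _ ↦ hentry i
  have hnab (i : Fin n) : IsDiffFieldAt (fun y ↦ nab (coordFrame p i) y (Y y)) x :=
    ((isSmoothFieldOn_nab nab hU ((isSmoothFieldOn_coordFrame p i).mono hUs) hY).contMDiffAt
      (hU.mem_nhds hx)).mdifferentiableAt (by simp)
  rw [hderiv, sum_apply, Matrix.trace, ← Finset.sum_add_distrib]
  exact Finset.sum_congr rfl fun i _ ↦ coordCoeff_nab nab (hUs hx) (hnab i) v i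

include hX in
theorem sum_coordCoeff_curvatureAux_coordFrame :
    ∑ i, coordCoeff p i x (curvatureAux nab (coordFrame p i) X Y x) =
      mvfderiv (𝓡 n) (fun y ↦ traceForm nab p y (Y y)) x (X x)
        - mvfderiv (𝓡 n) (fun y ↦ traceForm nab p y (X y)) x (Y x)
        - traceForm nab p x (VectorField.mlieBracket (𝓡 n) X Y x) := by
  have hbracket : ∑ i, coordCoeff p i x
      (nab (coordFrame p i) x (VectorField.mlieBracket (𝓡 n) X Y x)) =
        traceForm nab p x (VectorField.mlieBracket (𝓡 n) X Y x) := rfl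
  simp only [curvatureAux, map_sub, Finset.sum_sub_distrib]
  rw [hbracket, sum_coordCoeff_nab_nab_coordFrame nab hU hUs hx hY,
    sum_coordCoeff_nab_nab_coordFrame nab hU hUs hx hX, Matrix.trace_mul_comm]
  ring

end Trace

variable {nab}

theorem IsRicciSymmetric.mvfderiv_traceForm_comm (hRic : IsRicciSymmetric nab)
    (h : CovariantDerivative.torsion nab = 0)
    (hx : x ∈ (chartAt (EuclideanSpace ℝ (Fin n)) p).source) (j k : Fin n) :
    mvfderiv (𝓡 n) (fun y ↦ traceForm nab p y (coordFrame p k y)) x (coordFrame p j x) =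
      mvfderiv (𝓡 n) (fun y ↦ traceForm nab p y (coordFrame p j y)) x (coordFrame p k x) := by
  have hopen := (chartAt (EuclideanSpace ℝ (Fin n)) p).open_source
  choose F hF using fun i ↦
    exists_smoothVectorField_eventuallyEq hopen (isSmoothFieldOn_coordFrame p i) hx
  have hdiff (i : Fin n) : IsDiffFieldAt (coordFrame p i) x :=
    IsDiffFieldAt.congr (F i).mdifferentiableAt (hF i).symm
  have htrace := sum_coordCoeff_curvatureAux_coordFrame nab hopen subset_rfl hx
    (isSmoothFieldOn_coordFrame p j) (isSmoothFieldOn_coordFrame p k)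
  have hzero : ∑ i, coordCoeff p i x
      (curvatureAux nab (coordFrame p i) (coordFrame p j) (coordFrame p k) x) = 0 := by
    have hskew := ricci_sub_ricci (nab := nab) _ h
      (fun i ↦ (hF i).eq_of_nhds.trans (coordFrame_eq_basisAt hx i)) (F j) (F k)
    rw [hRic (F j) (F k) x, sub_self, zero_eq_neg] at hskew
    rw [← hskew]
    refine Finset.sum_congr rfl fun i _ ↦ ?_
    rw [curvatureAux_congr nab (hF i).symm (hdiff j) (hdiff k), coordCoeff_eq_repr_basisAt hx,
      (hF j).eq_of_nhds, (hF k).eq_of_nhds, curvature_apply nab (F i) (hdiff j) (hdiff k)]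
    rfl
  rw [hzero, mlieBracket_coordFrame hx, map_zero, sub_zero] at htrace
  exact (sub_eq_zero.1 htrace.symm)

end AffineConnection

/-! ### Closed one-forms on a chart -/

section ChartPrimitive

variable {p : M}

theorem mvfderiv_extChartAt_apply {x : M}
    (hx : x ∈ (chartAt (EuclideanSpace ℝ (Fin n)) p).source) (v : TangentSpace (𝓡 n) x) :
    mvfderiv (𝓡 n) (extChartAt (𝓡 n) p) x v =
      ∑ i, coordCoeff p i x v • EuclideanSpace.basisFun (Fin n) ℝ i := by
  conv_lhs => rw [← sum_coordCoeff_smul_coordFrame hx v]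
  simp only [map_sum, map_smul]
  exact Finset.sum_congr rfl fun i _ ↦ congrArg _ (mfderiv_extChartAt_coordFrame hx i)

theorem mvfderiv_comp_extChartAt {F : Type*} [NormedAddCommGroup F] [NormedSpace ℝ F] {x : M}
    (hx : x ∈ (chartAt (EuclideanSpace ℝ (Fin n)) p).source) {h : EuclideanSpace ℝ (Fin n) → F}
    {h' : EuclideanSpace ℝ (Fin n) →L[ℝ] F} (hh : HasFDerivAt h h' (extChartAt (𝓡 n) p x))
    (v : TangentSpace (𝓡 n) x) :
    mvfderiv (𝓡 n) (fun y ↦ h (extChartAt (𝓡 n) p y)) x v =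
      h' (∑ i, coordCoeff p i x v • EuclideanSpace.basisFun (Fin n) ℝ i) := by
  have : IsManifold (𝓡 n) 1 M := .of_le (n := ∞) ENat.LEInfty.out
  rw [mvfderiv_comp_of_hasFDerivAt hh (mdifferentiableAt_extChartAt hx),
    mvfderiv_extChartAt_apply hx]

theorem contDiffOn_comp_extChartAt_symm {g : M → ℝ}
    (hg : ContMDiffOn (𝓡 n) 𝓘(ℝ, ℝ) ∞ g (chartAt (EuclideanSpace ℝ (Fin n)) p).source) :
    ContDiffOn ℝ ∞ (g ∘ (extChartAt (𝓡 n) p).symm) (extChartAt (𝓡 n) p).target :=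
  (hg.comp (contMDiffOn_extChartAt_symm p) fun _ hz ↦
    extChartAt_source (𝓡 n) p ▸ (extChartAt (𝓡 n) p).map_target hz).contDiffOn

theorem fderiv_comp_extChartAt_symm {g : M → ℝ}
    (hg : ContMDiffOn (𝓡 n) 𝓘(ℝ, ℝ) ∞ g (chartAt (EuclideanSpace ℝ (Fin n)) p).source) {x : M}
    (hx : x ∈ (chartAt (EuclideanSpace ℝ (Fin n)) p).source) (j : Fin n) :
    fderiv ℝ (g ∘ (extChartAt (𝓡 n) p).symm) (extChartAt (𝓡 n) p x)
      (EuclideanSpace.basisFun (Fin n) ℝ j) = mvfderiv (𝓡 n) g x (coordFrame p j x) := by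
  have hx' : x ∈ (extChartAt (𝓡 n) p).source := by rwa [extChartAt_source]
  have hdiff : DifferentiableAt ℝ (g ∘ (extChartAt (𝓡 n) p).symm) (extChartAt (𝓡 n) p x) :=
    ((contDiffOn_comp_extChartAt_symm hg).contDiffAt
      (extChartAt_target_mem_nhds' ((extChartAt (𝓡 n) p).map_source hx'))).differentiableAt
      (by simp)
  have hlocal : g =ᶠ[nhds x]
      fun y ↦ (g ∘ (extChartAt (𝓡 n) p).symm) (extChartAt (𝓡 n) p y) :=
    Filter.eventually_of_mem ((isOpen_extChartAt_source p).mem_nhds hx') fun y hy ↦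
      congrArg g ((extChartAt (𝓡 n) p).left_inv hy).symm
  rw [show mvfderiv (𝓡 n) g x (coordFrame p j x) = _ from
      congrArg (fun L : TangentSpace (𝓡 n) x →L[ℝ] ℝ ↦ L (coordFrame p j x)) hlocal.mfderiv_eq]
  refine Eq.trans ?_ (mvfderiv_comp_extChartAt hx hdiff.hasFDerivAt _).symm
  simp only [coordCoeff_coordFrame hx, ite_smul, one_smul, zero_smul, Finset.sum_ite_eq',
    Finset.mem_univ, if_true]

theorem exists_contMDiffOn_mvfderiv_eq {θ : ∀ x : M, TangentSpace (𝓡 n) x →ₗ[ℝ] ℝ}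
    (hθ : ∀ k, ContMDiffOn (𝓡 n) 𝓘(ℝ, ℝ) ∞ (fun y ↦ θ y (coordFrame p k y))
      (chartAt (EuclideanSpace ℝ (Fin n)) p).source)
    (hclosed : ∀ x ∈ (chartAt (EuclideanSpace ℝ (Fin n)) p).source, ∀ j k,
      mvfderiv (𝓡 n) (fun y ↦ θ y (coordFrame p k y)) x (coordFrame p j x) =
        mvfderiv (𝓡 n) (fun y ↦ θ y (coordFrame p j y)) x (coordFrame p k x)) :
    ∃ U ⊆ (chartAt (EuclideanSpace ℝ (Fin n)) p).source, IsOpen U ∧ p ∈ U ∧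
      ∃ f : M → ℝ, ContMDiffOn (𝓡 n) 𝓘(ℝ, ℝ) ∞ f U ∧
        ∀ x ∈ U, ∀ v, mvfderiv (𝓡 n) f x v = θ x v := by
  let φ := extChartAt (𝓡 n) p
  have hsource : φ.source = (chartAt (EuclideanSpace ℝ (Fin n)) p).source :=
    extChartAt_source (𝓡 n) p
  have hsymm : ∀ z ∈ φ.target, ∀ j k,
      fderiv ℝ ((fun y ↦ θ y (coordFrame p k y)) ∘ φ.symm) z (EuclideanSpace.basisFun _ ℝ j) =
        fderiv ℝ ((fun y ↦ θ y (coordFrame p j y)) ∘ φ.symm) z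
          (EuclideanSpace.basisFun _ ℝ k) := by
    rw [← φ.image_source_eq_target]
    rintro _ ⟨x, hx, rfl⟩ j k
    rw [hsource] at hx
    rw [fderiv_comp_extChartAt_symm (hθ k) hx, fderiv_comp_extChartAt_symm (hθ j) hx,
      hclosed x hx j k]
  obtain ⟨B, -, hB, hpB, f, hf, hderiv⟩ := exists_contDiffOn_hasFDerivAt_sum_smul_proj
    (isOpen_extChartAt_target p) (mem_extChartAt_target p)
    (fun k ↦ contDiffOn_comp_extChartAt_symm (hθ k)) hsymm
  refine ⟨φ.source ∩ φ ⁻¹' B, fun x hx ↦ hsource ▸ hx.1,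
    (continuousOn_extChartAt p).isOpen_inter_preimage (isOpen_extChartAt_source p) hB,
    ⟨mem_extChartAt_source p, hpB⟩, fun y ↦ f (φ y), ?_, fun x hx v ↦ ?_⟩
  · exact hf.contMDiffOn.comp (contMDiffOn_extChartAt.mono fun x hx ↦ hsource ▸ hx.1)
      fun x hx ↦ hx.2
  · have hxs : x ∈ (chartAt (EuclideanSpace ℝ (Fin n)) p).source := hsource ▸ hx.1
    have hderiv_x : HasFDerivAt f
        (∑ k, θ x (coordFrame p k x) • (EuclideanSpace.proj k : _ →L[ℝ] ℝ)) (φ x) :=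
      (hderiv _ hx.2).congr_fderiv <| Finset.sum_congr rfl fun k _ ↦ congrArg (· • _) <|
        congrArg (fun y ↦ θ y (coordFrame p k y)) (φ.left_inv hx.1)
    rw [mvfderiv_comp_extChartAt hxs hderiv_x]
    conv_rhs => rw [← sum_coordCoeff_smul_coordFrame hxs v]
    simp [mul_comm]

end ChartPrimitive

/-! ### Parallel volume forms -/

section CoordVolumeForm

variable {p : M}

variable (p) in
/-- The form `dx₁ ∧ ⋯ ∧ dxₙ` of the preferred chart at `p`. -/
def coordVolumeForm (x : M) : TangentSpace (𝓡 n) x [⋀^Fin n]→ₗ[ℝ] ℝ :=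
  (Matrix.detRowAlternating (R := ℝ) (n := Fin n)).compLinearMap
    (LinearMap.pi fun i ↦ coordCoeff p i x)

theorem coordVolumeForm_apply (x : M) (Y : Fin n → TangentSpace (𝓡 n) x) :
    coordVolumeForm p x Y = (Matrix.of fun i j ↦ coordCoeff p j x (Y i)).det := rfl

theorem coordVolumeForm_coordFrame {x : M}
    (hx : x ∈ (chartAt (EuclideanSpace ℝ (Fin n)) p).source) :
    coordVolumeForm (n := n) p x (fun i ↦ coordFrame p i x) = 1 := by
  simp only [coordVolumeForm_apply, coordCoeff_coordFrame hx]
  exact (congrArg Matrix.det (Matrix.ext fun i j ↦ if_congr eq_comm rfl rfl)).trans Matrix.det_one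

theorem isVolumeFormOn_coordVolumeForm {U : Set M} (hU : IsOpen U)
    (hUs : U ⊆ (chartAt (EuclideanSpace ℝ (Fin n)) p).source) :
    IsVolumeFormOn (n := n) U (coordVolumeForm p) where
  smooth _ hY := contMDiffOn_det fun i j ↦ contMDiffOn_coordCoeff hU hUs (hY i) j
  ne_zero x hx hzero := one_ne_zero <| (coordVolumeForm_coordFrame (hUs hx)).symm.trans <|
    congrArg (fun vol ↦ vol fun i ↦ coordFrame p i x) hzero

theorem IsVolumeFormOn.exp_smul {U : Set M}
    {vol : ∀ x : M, TangentSpace (𝓡 n) x [⋀^Fin n]→ₗ[ℝ] ℝ} (hvol : IsVolumeFormOn U vol)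
    {f : M → ℝ} (hf : ContMDiffOn (𝓡 n) 𝓘(ℝ, ℝ) ∞ f U) :
    IsVolumeFormOn U fun x ↦ Real.exp (f x) • vol x where
  smooth Y hY := (Real.contDiff_exp.contMDiff.comp_contMDiffOn hf).mul (hvol.smooth Y hY)
  ne_zero x hx := smul_ne_zero (Real.exp_ne_zero _) (hvol.ne_zero x hx)

namespace AffineConnection

variable (nab : AffineConnection n M) {x : M} {Y : Fin n → ∀ x : M, TangentSpace (𝓡 n) x}

theorem covDerivForm_smul {h : M → ℝ} {vol : ∀ x : M, TangentSpace (𝓡 n) x [⋀^Fin n]→ₗ[ℝ] ℝ}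
    (hh : MDifferentiableAt (𝓡 n) 𝓘(ℝ, ℝ) h x)
    (hvol : MDifferentiableAt (𝓡 n) 𝓘(ℝ, ℝ) (fun y ↦ vol y fun i ↦ Y i y) x)
    (v : TangentSpace (𝓡 n) x) :
    covDerivForm nab (fun y ↦ h y • vol y) Y x v =
      mvfderiv (𝓡 n) h x v * vol x (fun i ↦ Y i x) + h x * covDerivForm nab vol Y x v := by
  have hleib := DFunLike.congr_fun (mvfderiv_fun_mul hh hvol) v
  simp only [covDerivForm, AlternatingMap.smul_apply, smul_eq_mul, ← Finset.mul_sum]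
  rw [hleib]
  simp only [add_apply, smul_apply, smul_eq_mul]
  ring

theorem covDerivForm_coordVolumeForm (hx : x ∈ (chartAt (EuclideanSpace ℝ (Fin n)) p).source)
    (hY : ∀ i, IsDiffFieldAt (Y i) x) (v : TangentSpace (𝓡 n) x) :
    covDerivForm nab (coordVolumeForm p) Y x v =
      -(traceForm nab p x v * coordVolumeForm p x fun i ↦ Y i x) := by
  let A (y : M) : Matrix (Fin n) (Fin n) ℝ := .of fun i j ↦ coordCoeff p j y (Y i y)
  let dA (i j : Fin n) : ℝ := mvfderiv (𝓡 n) (fun y ↦ A y i j) x v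
  let Γ := connectionForm nab p x v
  have hA (i j : Fin n) : MDifferentiableAt (𝓡 n) 𝓘(ℝ, ℝ) (fun y ↦ A y i j) x :=
    mdifferentiableAt_coordCoeff hx (hY i) j
  have hrow (i : Fin n) : coordVolumeForm p x
      (Function.update (fun j ↦ Y j x) i (nab (Y i) x v)) =
        ((A x).updateRow i (dA i)).det + ((A x).updateRow i ((A x * Γ) i)).det := by
    rw [coordVolumeForm_apply, ← Matrix.det_updateRow_add]
    congr 1
    ext k j
    rcases eq_or_ne k i with rfl | hk
    · simpa using! coordCoeff_nab nab hx (hY k) v j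
    · simp [hk, A]
  calc covDerivForm nab (coordVolumeForm p) Y x v
      = mvfderiv (𝓡 n) (fun y ↦ (A y).det) x v - ∑ i, (((A x).updateRow i (dA i)).det
          + ((A x).updateRow i ((A x * Γ) i)).det) :=
        congrArg _ (Finset.sum_congr rfl fun i _ ↦ hrow i)
    _ = -∑ i, ((A x).updateRow i ((A x * Γ) i)).det := by
        rw [mvfderiv_det hA, Finset.sum_add_distrib, sub_add_cancel_left]
    _ = -(traceForm nab p x v * coordVolumeForm p x fun i ↦ Y i x) :=
        congrArg _ (sum_det_updateRow_mul (A x) Γ)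

theorem isParallelOn_exp_smul_coordVolumeForm {U : Set M} (hU : IsOpen U)
    (hUs : U ⊆ (chartAt (EuclideanSpace ℝ (Fin n)) p).source) {f : M → ℝ}
    (hf : ∀ x ∈ U, MDifferentiableAt (𝓡 n) 𝓘(ℝ, ℝ) f x)
    (hdf : ∀ x ∈ U, ∀ v, mvfderiv (𝓡 n) f x v = traceForm nab p x v) :
    IsParallelOn nab U fun x ↦ Real.exp (f x) • coordVolumeForm p x := by
  intro Y hY x hx v
  have hexp := (Real.hasDerivAt_exp (f x)).hasFDerivAt
  have hexpf : MDifferentiableAt (𝓡 n) 𝓘(ℝ, ℝ) (fun y ↦ Real.exp (f y)) x :=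
    hexp.differentiableAt.mdifferentiableAt.comp x (hf x hx)
  have hYx (i : Fin n) : IsDiffFieldAt (Y i) x :=
    ((hY i).contMDiffAt (hU.mem_nhds hx)).mdifferentiableAt (by simp)
  have hvol : MDifferentiableAt (𝓡 n) 𝓘(ℝ, ℝ) (fun y ↦ coordVolumeForm p y fun i ↦ Y i y) x :=
    mdifferentiableAt_det fun i j ↦ mdifferentiableAt_coordCoeff (hUs hx) (hYx i) j
  rw [covDerivForm_smul nab hexpf hvol, covDerivForm_coordVolumeForm nab (hUs hx) hYx,
    mvfderiv_comp_of_hasFDerivAt hexp (hf x hx), hdf x hx]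
  simp only [ContinuousLinearMap.toSpanSingleton_apply, smul_eq_mul]
  ring

variable {nab}

theorem IsRicciSymmetric.isEquiaffine [T2Space M]
    [CovariantDerivative.ContMDiffCovariantDerivative nab ∞] (hRic : IsRicciSymmetric nab)
    (h : CovariantDerivative.torsion nab = 0) : IsEquiaffine nab := fun p ↦ by
  obtain ⟨U, hUs, hU, hpU, f, hf, hdf⟩ := exists_contMDiffOn_mvfderiv_eq (p := p)
    (fun k ↦ contMDiffOn_traceForm nab (chartAt _ p).open_source subset_rfl
      (isSmoothFieldOn_coordFrame p k))
    fun x hx j k ↦ hRic.mvfderiv_traceForm_comm h hx j k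
  exact ⟨U, hU, hpU, fun x ↦ Real.exp (f x) • coordVolumeForm p x,
    (isVolumeFormOn_coordVolumeForm hU hUs).exp_smul hf,
    isParallelOn_exp_smul_coordVolumeForm nab hU hUs
      (fun x hx ↦ (hf.contMDiffAt (hU.mem_nhds hx)).mdifferentiableAt (by simp)) hdf⟩

end AffineConnection

end CoordVolumeForm

end StatisticalManifold

end

theorem theorem3p1 {n : ℕ} {M : Type*} [TopologicalSpace M] [T2Space M]
    [ChartedSpace (EuclideanSpace ℝ (Fin n)) M] [IsManifold (𝓡 n) ∞ M]
    (g : SmoothMetric n M) (nab nabS : AffineConnection n M)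
    [CovariantDerivative.ContMDiffCovariantDerivative nab ∞]
    [CovariantDerivative.ContMDiffCovariantDerivative nabS ∞]
    (hstat : AffineConnection.IsStatistical g nab)
    (hdual : AffineConnection.IsDual g nab nabS)
    (hRic : AffineConnection.IsConjugateRicciSymmetric nab nabS) :
    AffineConnection.IsRicciSymmetric nab ∧ AffineConnection.IsEquiaffine nab := by
  have hsymm : AffineConnection.IsRicciSymmetric nab :=
    hRic.isRicciSymmetric hdual hstat.torsion_free (hstat.torsion_dual_eq_zero hdual)
  exact ⟨hsymm, hsymm.isEquiaffine hstat.torsion_free⟩
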